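/- Let $d\ge 1$ and $m\ge 2$. Let $\mathcal{A}$ be an arrangement in $\mathbb{R}^d$ consisting of $m$ distinct affine hyperplanes, and let $p\in\mathbb{R}^d$ be a point lying on no $H\in\mathcal{A}$. Consider a directed line $L$ through $p$ that is not parallel to any $H\in\mathcal{A}$ and does not meet two distinct hyperplanes of $\mathcal{A}$ in the same point. A point that leaves $p$ in the direction of $L$, runs out to infinity, and comes back to $p$ from infinity on the opposite side, always moving in the direction of $L$ (as for line shellings), crosses the hyperplanes of $\mathcal{A}$ in some order $H_1,\dots,H_m$; the sequences $(H_1,\dots,H_m)$ obtained from all such $L$ are the *valid orderings* of $\mathcal{A}$ with respect to $p$, and $v(\mathcal{A},p)$ denotes their number. Let $c(m,k)$ be the signless Stirling number of the first kind, i.e., the number of permutations of an $m$-element set with exactly $k$ cycles (so $c(m,k)=0$ for $k<0$ and for $k>m$). Then $$ v(\mathcal{A},p)\;\le\; 2\bigl(c(m,m-d+1)+c(m,m-d+3)+c(m,m-d+5)+\cdots\bigr), $$ and this inequality is best possible: for all $d\ge 1$ and $m\ge 2$ there are an arrangement $\mathcal{A}$ of $m$ hyperplanes in $\mathbb{R}^d$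 and a point $p$ on none of them for which equality holds. -/

import Mathlib

namespace ValidOrder

/-- An affine hyperplane of `ℝ^d`: a nonempty affine subspace of codimension one. -/
def IsHyperplane {d : ℕ} (H : AffineSubspace ℝ (Fin d → ℝ)) : Prop :=
  (H : Set (Fin d → ℝ)).Nonempty ∧ Module.finrank ℝ H.direction + 1 = d

/-- A hyperplane arrangement in `ℝ^d`: a finite set of affine hyperplanes. -/
def IsArrangement {d : ℕ} (A : Finset (AffineSubspace ℝ (Fin d → ℝ))) : Prop :=
  ∀ H ∈ A, IsHyperplane H

/-- `Before s t`, for two nonzero parameters on a line `r ↦ p + r • u`: a point that leaves `p` in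
the direction of `u`, runs out to infinity, and comes back in from infinity on the other side of
`p`, still moving in the direction of `u`, meets the point with parameter `s` before the one with
parameter `t`.  So all positive parameters come first, in increasing order, and then all negative
parameters, in increasing order. -/
def Before (s t : ℝ) : Prop :=
  (0 < s ∧ t < 0) ∨ (0 < s ∧ 0 < t ∧ s < t) ∨ (s < 0 ∧ t < 0 ∧ s < t)

/-- The directed line through `p` with direction vector `u` is admissible for `A`: it is parallel
to no hyperplane of `A`, and it meets distinct hyperplanes of `A` in distinct points, `p + t H • u`
being its point of intersection with `H`. -/
def Crosses {d : ℕ} (A : Finset (AffineSubspace ℝ (Fin d → ℝ))) (p u : Fin d → ℝ)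
    (t : AffineSubspace ℝ (Fin d → ℝ) → ℝ) : Prop :=
  u ≠ 0 ∧ (∀ H ∈ A, u ∉ H.direction ∧ p + t H • u ∈ H) ∧
    Set.InjOn t (A : Set (AffineSubspace ℝ (Fin d → ℝ)))

/-- `l` is a valid ordering of `A` with respect to `p`: it lists every hyperplane of `A` exactly
once, in the order in which some admissible directed line through `p` crosses them. -/
def IsValidOrdering {d : ℕ} (A : Finset (AffineSubspace ℝ (Fin d → ℝ))) (p : Fin d → ℝ)
    (l : List (AffineSubspace ℝ (Fin d → ℝ))) : Prop :=
  l.Nodup ∧ (∀ H, H ∈ l ↔ H ∈ A) ∧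
    ∃ (u : Fin d → ℝ) (t : AffineSubspace ℝ (Fin d → ℝ) → ℝ),
      Crosses A p u t ∧ l.Pairwise (fun H H' => Before (t H) (t H'))

theorem finite_setOf_isValidOrdering {d : ℕ} (A : Finset (AffineSubspace ℝ (Fin d → ℝ)))
    (p : Fin d → ℝ) : {l | IsValidOrdering A p l}.Finite := by
  refine (A.toList.permutations.finite_toSet).subset ?_
  rintro l ⟨hl, hA, -⟩
  refine List.mem_permutations.2 ((List.perm_ext_iff_of_nodup hl A.nodup_toList).2 ?_)
  intro H
  rw [hA, Finset.mem_toList]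

/-- `v(A, p)`, the number of valid orderings of `A` with respect to `p`. -/
noncomputable def v {d : ℕ} (A : Finset (AffineSubspace ℝ (Fin d → ℝ))) (p : Fin d → ℝ) : ℕ :=
  {l | IsValidOrdering A p l}.ncard

/-- The signless Stirling number `c(n, k)` of the first kind for an integer `k`; it vanishes for
negative `k`. -/
def c (n : ℕ) (k : ℤ) : ℕ := if k < 0 then 0 else Nat.stirlingFirst n k.toNat

/-- `2 (c(m, m-d+1) + c(m, m-d+3) + c(m, m-d+5) + ⋯)`.  The terms with `i ≥ d` vanish, since then
`m - d + 1 + 2 * i > m`. -/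
def bound (d m : ℕ) : ℕ :=
  2 * ∑ i ∈ Finset.range d, c m ((m : ℤ) - (d : ℤ) + 1 + 2 * (i : ℤ))

end ValidOrder

/-!
Write each hyperplane of the arrangement as `{x | φ (x - p) = 1}` for a linear functional `φ`.
A directed line `r ↦ p + r • u` meets it at the parameter `(φ u)⁻¹`, and the order in which a
traveller through infinity meets the hyperplanes is the decreasing order of the numbers `φ u`
(`before_inv_iff`).  Hence `v A p` is the number of strict orders that vectors `u` induce on `m`
distinct functionals by evaluation (`v_eq_ncard_orders`); a small perturbation of `u` takes care of
lines parallel to some hyperplane.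

These orders are counted on subspaces `S` of the space of vectors.  The vectors inducing a given
order on all functionals but the last one `g` form an open convex cone of `S`.  Inside this cone,
crossing a hyperplane `F j = g` moves `g` past `F j`, so the number of ways to insert `g` is one
more than the number of hyperplanes `F j = g` that meet the cone (`ncard_cuts`).  Summing over the
orders of the first functionals gives an exact recursion (`ncard_orders_succ`): the number for
`m + 1` functionals on `S` is the number for `m` functionals on `S`, plus the sum over `j` of the
numbers for `m` functionals on `S ∩ {F j = g}`, provided that no `F j - g` vanishes on `S`.  Since
the Stirling sum `bound` satisfies the corresponding recursion in the dimension and in `m`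
(`bound_succ_succ`), induction gives the inequality (`ncard_orders_le`); if some `F j - g` vanishes
on `S`, no order is induced at all.

Equality holds as soon as each hyperplane section occurring in the recursion has the expected
dimension.  These sections are the subspaces on which `f i = f j` for all edges of a forest on the
indices, which leads to the notion of general position in `Generic`.  Functionals in general
position are found one at a time, since each only has to avoid finitely many proper affine
subspaces of the dual space (`exists_generic`).
-/

open Filter Topology

namespace ValidOrder

/-! ### The recursion for orders induced by vectors -/

section Recursion

variable {V : Type*} [AddCommGroup V] [Module ℝ V]

/-- The strict order that the values at `u` of the functionals `F i` induce on the indices, as a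
set of pairs. -/
def code {m : ℕ} (F : Fin m → Module.Dual ℝ V) (u : V) : Set (Fin m × Fin m) :=
  {q | F q.1 u < F q.2 u}

/-- The set of vectors of `S` at which the functionals `F i` take distinct values, ordered as
prescribed by `σ`: an open region of the arrangement of the hyperplanes `F i = F j` in `S`. -/
def cell {m : ℕ} (F : Fin m → Module.Dual ℝ V) (S : Submodule ℝ V) (σ : Set (Fin m × Fin m)) :
    Set V :=
  {u | u ∈ S ∧ Function.Injective (fun i => F i u) ∧ code F u = σ}

/-- The strict total orders on the indices that are induced by vectors of `S`. -/
def orders {m : ℕ} (F : Fin m → Module.Dual ℝ V) (S : Submodule ℝ V) :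
    Set (Set (Fin m × Fin m)) :=
  {σ | (cell F S σ).Nonempty}

variable {m : ℕ} {F : Fin m → Module.Dual ℝ V} {S : Submodule ℝ V} {σ : Set (Fin m × Fin m)}

theorem lt_iff_of_mem_cell {u : V} (hu : u ∈ cell F S σ) (i j : Fin m) :
    F i u < F j u ↔ (i, j) ∈ σ := by
  rw [← hu.2.2]; rfl

theorem mem_cell_of_lt_imp {u u' : V} (hu : u ∈ cell F S σ) (hS : u' ∈ S)
    (h : ∀ i j, F i u < F j u → F i u' < F j u') : u' ∈ cell F S σ := by
  refine ⟨hS, ?_, ?_⟩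
  · intro i j hij
    by_contra hne
    rcases lt_or_gt_of_ne (fun e => hne (hu.2.1 e)) with hlt | hlt
    · exact (h _ _ hlt).ne hij
    · exact (h _ _ hlt).ne hij.symm
  · ext ⟨i, j⟩
    rw [← lt_iff_of_mem_cell hu]
    refine ⟨fun hlt : F i u' < F j u' => ?_, h i j⟩
    by_contra hnot
    rcases (not_lt.1 hnot).lt_or_eq with h' | h'
    · exact lt_asymm (h _ _ h') hlt
    · have := hu.2.1 h'
      subst this
      exact lt_irrefl _ hlt

theorem smul_add_smul_mem_cell {u u' : V} (hu : u ∈ cell F S σ) (hu' : u' ∈ cell F S σ) {x y : ℝ}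
    (hx : 0 < x) (hy : 0 < y) : x • u + y • u' ∈ cell F S σ := by
  refine mem_cell_of_lt_imp hu (S.add_mem (S.smul_mem _ hu.1) (S.smul_mem _ hu'.1)) ?_
  intro i j hij
  have hij' := (lt_iff_of_mem_cell hu' i j).2 ((lt_iff_of_mem_cell hu i j).1 hij)
  simp only [map_add, map_smul, smul_eq_mul]
  gcongr

theorem eventually_apply_add_smul_lt {a b : Module.Dual ℝ V} {u : V} (h : a u < b u) (w : V) :
    ∀ᶠ ε : ℝ in 𝓝 0, a (u + ε • w) < b (u + ε • w) := by
  simp only [map_add, map_smul, smul_eq_mul]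
  have h1 : ContinuousAt (fun ε : ℝ => a u + ε * a w) 0 := by fun_prop
  have h2 : ContinuousAt (fun ε : ℝ => b u + ε * b w) 0 := by fun_prop
  exact h1.eventually_lt h2 (by simpa using h)

theorem eventually_add_smul_mem_cell {u w : V} (hu : u ∈ cell F S σ) (hw : w ∈ S) :
    ∀ᶠ ε : ℝ in 𝓝 0, u + ε • w ∈ cell F S σ := by
  have h : ∀ᶠ ε : ℝ in 𝓝 0, ∀ i j, F i u < F j u → F i (u + ε • w) < F j (u + ε • w) := by
    simp only [eventually_all]
    exact fun i j hij => eventually_apply_add_smul_lt hij w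
  filter_upwards [h] with ε hε
  exact mem_cell_of_lt_imp hu (S.add_mem hu.1 (S.smul_mem _ hw)) hε

/-- The ways in which a further functional `g` can be inserted into the order `σ`, each recorded by
the set of indices placed below `g`. -/
def cuts (F : Fin m → Module.Dual ℝ V) (g : Module.Dual ℝ V) (S : Submodule ℝ V)
    (σ : Set (Fin m × Fin m)) : Set (Set (Fin m)) :=
  {D | ∃ u ∈ cell F S σ, (∀ j, F j u ≠ g u) ∧ {k | F k u < g u} = D}

/-- If `g` meets `F j` inside a cell, then moving slightly to either side inserts `g` immediately
above, respectively immediately below, the index `j`. -/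
theorem cuts_of_meet {g : Module.Dual ℝ V} {j : Fin m} {u w : V} (hu : u ∈ cell F S σ)
    (hj : F j u = g u) (hw : w ∈ S) (hgw : F j w < g w) :
    {k | (k, j) ∈ σ ∨ k = j} ∈ cuts F g S σ ∧ {k | (k, j) ∈ σ} ∈ cuts F g S σ := by
  have hσ : ∀ k, (k, j) ∈ σ ↔ F k u < g u := by
    intro k; rw [← lt_iff_of_mem_cell hu, hj]
  have hother : ∀ᶠ ε : ℝ in 𝓝 0, ∀ k, k ≠ j →
      F k (u + ε • w) ≠ g (u + ε • w) ∧ (F k (u + ε • w) < g (u + ε • w) ↔ (k, j) ∈ σ) := by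
    simp only [eventually_all]
    intro k hk
    rcases lt_trichotomy (F k u) (g u) with h | h | h
    · filter_upwards [eventually_apply_add_smul_lt h w] with ε hε
      exact ⟨hε.ne, iff_of_true hε ((hσ k).2 h)⟩
    · exact absurd (hu.2.1 (h.trans hj.symm)) hk
    · filter_upwards [eventually_apply_add_smul_lt h w] with ε hε
      exact ⟨hε.ne', iff_of_false hε.not_gt (fun h' => h.not_gt ((hσ k).1 h'))⟩
  have hall := (eventually_add_smul_mem_cell hu hw).and hother
  constructor
  · obtain ⟨ε, hε, hc, ho⟩ := ((frequently_gt_nhds (0 : ℝ)).and_eventually hall).exists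
    have hjε : F j (u + ε • w) < g (u + ε • w) := by
      simp only [map_add, map_smul, smul_eq_mul, hj]
      gcongr
    refine ⟨_, hc, fun k => ?_, ?_⟩
    · by_cases hk : k = j
      · exact hk ▸ hjε.ne
      · exact (ho k hk).1
    · ext k
      by_cases hk : k = j
      · exact iff_of_true (hk ▸ hjε) (Or.inr hk)
      · exact (ho k hk).2.trans ⟨Or.inl, fun h => h.resolve_right hk⟩
  · obtain ⟨ε, hε, hc, ho⟩ := ((frequently_lt_nhds (0 : ℝ)).and_eventually hall).exists
    have hjε : g (u + ε • w) < F j (u + ε • w) := by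
      simp only [map_add, map_smul, smul_eq_mul, hj]
      have := mul_lt_mul_of_neg_left hgw hε
      linarith
    refine ⟨_, hc, fun k => ?_, ?_⟩
    · by_cases hk : k = j
      · exact hk ▸ hjε.ne'
      · exact (ho k hk).1
    · ext k
      by_cases hk : k = j
      · exact iff_of_false (fun h => hjε.not_gt (hk ▸ h))
          (fun h => ((hσ k).1 h).ne (hk ▸ hj))
      · exact (ho k hk).2

/-- The number of ways to insert `g` into a realised order exceeds by one the number of indices `j`
that `g` can meet inside the cell: apart from the lowest insertion, every insertion is the one
immediately above such a `j`. -/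
theorem ncard_cuts {g : Module.Dual ℝ V} (hσ : σ ∈ orders F S)
    (hg : ∀ j, ∃ w ∈ S, F j w ≠ g w) :
    (cuts F g S σ).ncard = {j | ∃ u ∈ cell F S σ, F j u = g u}.ncard + 1 := by
  obtain ⟨v, hv⟩ := hσ
  have hmeet : ∀ j, (∃ u ∈ cell F S σ, F j u = g u) →
      {k | (k, j) ∈ σ ∨ k = j} ∈ cuts F g S σ ∧ {k | (k, j) ∈ σ} ∈ cuts F g S σ := by
    rintro j ⟨u, hu, hj⟩
    obtain ⟨w, hw, hne⟩ := hg j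
    rcases lt_or_gt_of_ne hne with h | h
    · exact cuts_of_meet hu hj hw h
    · exact cuts_of_meet hu hj (S.neg_mem hw) (by simpa using h)
  have hne : (cuts F g S σ).Nonempty := by
    by_cases hE : ∃ j, F j v = g v
    · obtain ⟨j, hj⟩ := hE
      exact ⟨_, (hmeet j ⟨v, hv, hj⟩).1⟩
    · exact ⟨_, v, hv, fun j hj => hE ⟨j, hj⟩, rfl⟩
  have hirr : ∀ j, (j, j) ∉ σ := fun j h => lt_irrefl _ ((lt_iff_of_mem_cell hv j j).2 h)
  obtain ⟨D₀, hD₀, hmin⟩ := (Set.toFinite (cuts F g S σ)).exists_minimalFor Set.ncard _ hne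
  have hmin' : ∀ D ∈ cuts F g S σ, ¬ D ⊂ D₀ := fun D hD hlt =>
    absurd (hmin hD (Set.ncard_le_ncard hlt.subset)) (not_le.2 (Set.ncard_lt_ncard hlt))
  have himage : cuts F g S σ = insert D₀
      ((fun j => {k | (k, j) ∈ σ ∨ k = j}) '' {j | ∃ u ∈ cell F S σ, F j u = g u}) := by
    apply Set.Subset.antisymm
    · intro D hD
      by_cases hDD : D = D₀
      · exact Or.inl hDD
      right
      have hD' := hD
      obtain ⟨u, hu, hu1, rfl⟩ := hD
      obtain ⟨u₀, hu₀, -, rfl⟩ := id hD₀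
      -- `D₀` is minimal, so some index lies in the new cut but not in `D₀`
      have hsub : ∃ j, F j u < g u ∧ ¬ F j u₀ < g u₀ := by
        by_contra! hcon
        exact hmin' _ hD' (Set.ssubset_iff_subset_ne.2 ⟨hcon, hDD⟩)
      obtain ⟨j₁, hj₁, hj₁'⟩ := hsub
      obtain ⟨j, hj, hjmax⟩ := (Set.toFinite {k | F k u < g u}).exists_maximalFor
        (fun k => F k u) _ ⟨j₁, hj₁⟩
      -- the topmost index below `g` at `u` is not below `g` at `u₀`, as both vectors order the
      -- indices alike
      have hj₀ : g u₀ ≤ F j u₀ := by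
        have h : F j₁ u ≤ F j u := (le_total (F j₁ u) (F j u)).elim id (hjmax hj₁)
        refine (not_lt.1 hj₁').trans ?_
        by_contra hlt
        have := (lt_iff_of_mem_cell hu _ _).2 ((lt_iff_of_mem_cell hu₀ _ _).1 (not_le.1 hlt))
        exact absurd h (not_le.2 this)
      refine ⟨j, ?_, ?_⟩
      · rcases hj₀.lt_or_eq with hlt | heq
        · -- `g - F j` changes sign between `u₀` and `u`; these weights give its zero in the cone
          refine ⟨_, smul_add_smul_mem_cell hu₀ hu (sub_pos.2 hj) (sub_pos.2 hlt), ?_⟩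
          simp only [map_add, map_smul, smul_eq_mul]
          ring
        · exact ⟨u₀, hu₀, heq.symm⟩
      · ext k
        simp only [Set.mem_ofPred_eq, ← lt_iff_of_mem_cell hu]
        constructor
        · rintro (h | rfl)
          · exact h.trans hj
          · exact hj
        · intro h
          have hle : F k u ≤ F j u := (le_total (F k u) (F j u)).elim id (hjmax h)
          exact hle.lt_or_eq.imp_right (fun e => hu.2.1 e)
    · rintro D (rfl | ⟨j, hj, rfl⟩)
      · exact hD₀
      · exact (hmeet j hj).1
  rw [himage, Set.ncard_insert_of_notMem, Set.ncard_image_of_injective]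
  · intro i j hij
    by_contra hne'
    have h1 : i ∈ {k | (k, j) ∈ σ ∨ k = j} := (Set.ext_iff.1 hij i).1 (Or.inr rfl)
    have h2 : j ∈ {k | (k, i) ∈ σ ∨ k = i} := (Set.ext_iff.1 hij j).2 (Or.inr rfl)
    have h1' := (lt_iff_of_mem_cell hv _ _).2 (h1.resolve_right hne')
    have h2' := (lt_iff_of_mem_cell hv _ _).2 (h2.resolve_right (Ne.symm hne'))
    exact lt_asymm h1' h2'
  · rintro ⟨j, hj, rfl⟩
    refine hmin' _ (hmeet j hj).2 (Set.ssubset_iff_of_subset (fun k hk => Or.inl hk) |>.2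
      ⟨j, Or.inr rfl, hirr j⟩)

/-- Restricting an order of `m + 1` functionals to the first `m` of them, and recording where the
last one sits, identifies the realised orders with pairs of a realised order and a cut. -/
theorem ncard_orders_succ_eq_sum_cuts (F : Fin (m + 1) → Module.Dual ℝ V) (S : Submodule ℝ V) :
    (orders F S).ncard = ∑ σ ∈ (Set.toFinite (orders (fun i : Fin m => F i.castSucc) S)).toFinset,
      (cuts (fun i : Fin m => F i.castSucc) (F (Fin.last m)) S σ).ncard := by
  classical
  have hrestrict : ∀ s ∈ orders F S, {q : Fin m × Fin m | (q.1.castSucc, q.2.castSucc) ∈ s} ∈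
      orders (fun i : Fin m => F i.castSucc) S := by
    rintro s ⟨u, hu⟩
    refine ⟨u, hu.1, hu.2.1.comp (Fin.castSucc_injective m), ?_⟩
    ext ⟨i, j⟩
    exact lt_iff_of_mem_cell hu _ _
  rw [Set.ncard_eq_toFinset_card _ (Set.toFinite (orders F S)),
    Finset.card_eq_sum_card_fiberwise
      (f := fun s => {q : Fin m × Fin m | (q.1.castSucc, q.2.castSucc) ∈ s})
      (t := (Set.toFinite (orders (fun i : Fin m => F i.castSucc) S)).toFinset)]
  swap
  · intro s hs
    simp only [Finset.mem_coe, Set.Finite.mem_toFinset] at hs ⊢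
    exact hrestrict s hs
  refine Finset.sum_congr rfl fun σ hσ => ?_
  rw [Set.ncard_eq_toFinset_card _ (Set.toFinite (cuts _ _ _ _))]
  refine Finset.card_bij (fun s _ => {k : Fin m | (k.castSucc, Fin.last m) ∈ s}) ?_ ?_ ?_
  · intro s hs
    rw [Finset.mem_filter, Set.Finite.mem_toFinset] at hs
    obtain ⟨⟨u, hu⟩, rfl⟩ := hs
    rw [Set.Finite.mem_toFinset]
    refine ⟨u, ⟨hu.1, hu.2.1.comp (Fin.castSucc_injective m), ?_⟩, ?_, ?_⟩
    · ext ⟨i, j⟩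
      exact lt_iff_of_mem_cell hu _ _
    · exact fun j hj => (Fin.castSucc_lt_last j).ne (hu.2.1 hj)
    · ext k
      exact lt_iff_of_mem_cell hu _ _
  · intro s hs s' hs' heq
    rw [Finset.mem_filter, Set.Finite.mem_toFinset] at hs hs'
    obtain ⟨⟨u, hu⟩, hsσ⟩ := hs
    obtain ⟨⟨u', hu'⟩, hsσ'⟩ := hs'
    have key : ∀ i j, (i, j) ∈ s ↔ F i u < F j u := fun i j => (lt_iff_of_mem_cell hu i j).symm
    have key' : ∀ i j, (i, j) ∈ s' ↔ F i u' < F j u' :=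
      fun i j => (lt_iff_of_mem_cell hu' i j).symm
    have hlast : ∀ k : Fin m, (k.castSucc, Fin.last m) ∈ s ↔ (k.castSucc, Fin.last m) ∈ s' :=
      fun k => Set.ext_iff.1 heq k
    have hne : ∀ k : Fin m, F (Fin.last m) u ≠ F k.castSucc u :=
      fun k h => (Fin.castSucc_lt_last k).ne' (hu.2.1 h)
    have hne' : ∀ k : Fin m, F (Fin.last m) u' ≠ F k.castSucc u' :=
      fun k h => (Fin.castSucc_lt_last k).ne' (hu'.2.1 h)
    ext ⟨i, j⟩
    induction i using Fin.lastCases with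
    | last =>
      induction j using Fin.lastCases with
      | last => simp [key, key']
      | cast j =>
        have := hlast j
        rw [key, key'] at this ⊢
        rw [← Ne.le_iff_lt (hne j), ← Ne.le_iff_lt (hne' j), ← not_lt, ← not_lt, this]
    | cast i =>
      induction j using Fin.lastCases with
      | last => exact hlast i
      | cast j => exact Set.ext_iff.1 (hsσ.trans hsσ'.symm) (i, j)
  · intro D hD
    rw [Set.Finite.mem_toFinset] at hD
    obtain ⟨u, hu, hne, rfl⟩ := hD
    refine ⟨code F u, ?_, rfl⟩
    rw [Finset.mem_filter, Set.Finite.mem_toFinset]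
    refine ⟨⟨u, hu.1, ?_, rfl⟩, hu.2.2⟩
    intro i j hij
    induction i using Fin.lastCases with
    | last =>
      induction j using Fin.lastCases with
      | last => rfl
      | cast j => exact absurd hij.symm (hne j)
    | cast i =>
      induction j using Fin.lastCases with
      | last => exact absurd hij (hne i)
      | cast j => exact congrArg Fin.castSucc (hu.2.1 hij)

/-- The recursion for the number of realised orders.  The orders of the first `m` functionals that
are realised on the hyperplane where the last functional meets `F j` account for the new orders
in which the last functional sits immediately above `F j`. -/
theorem ncard_orders_succ (F : Fin (m + 1) → Module.Dual ℝ V) (S : Submodule ℝ V)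
    (h : ∀ j : Fin m, ∃ w ∈ S, F j.castSucc w ≠ F (Fin.last m) w) :
    (orders F S).ncard = (orders (fun i : Fin m => F i.castSucc) S).ncard +
      ∑ j : Fin m, (orders (fun i : Fin m => F i.castSucc)
        (S ⊓ LinearMap.ker (F (Fin.last m) - F j.castSucc))).ncard := by
  classical
  set G : Fin m → Module.Dual ℝ V := fun i => F i.castSucc with hG
  set T := (Set.toFinite (orders G S)).toFinset with hT
  let P : Set (Fin m × Fin m) → Fin m → Prop :=
    fun σ j => ∃ u ∈ cell G S σ, F j.castSucc u = F (Fin.last m) u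
  have hcuts : ∀ σ ∈ T, (cuts G (F (Fin.last m)) S σ).ncard =
      (Finset.univ.bipartiteAbove P σ).card + 1 := by
    intro σ hσ
    rw [ncard_cuts ((Set.Finite.mem_toFinset _).1 hσ) h,
      Set.ncard_eq_toFinset_card _ (Set.toFinite _)]
    congr 2
    ext j
    simp [Finset.bipartiteAbove, P, G]
  have hmeet : ∀ j ∈ (Finset.univ : Finset (Fin m)), (T.bipartiteBelow P j).card =
      (orders G (S ⊓ LinearMap.ker (F (Fin.last m) - F j.castSucc))).ncard := by
    intro j _
    rw [Set.ncard_eq_toFinset_card _ (Set.toFinite _)]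
    congr 1
    ext σ
    rw [Finset.mem_bipartiteBelow, Set.Finite.mem_toFinset, Set.Finite.mem_toFinset]
    constructor
    · rintro ⟨-, u, hu, hj⟩
      refine ⟨u, ⟨hu.1, ?_⟩, hu.2⟩
      simp [hj]
    · rintro ⟨u, ⟨hS, hker⟩, hu⟩
      refine ⟨⟨u, hS, hu⟩, u, ⟨hS, hu⟩, ?_⟩
      have : F (Fin.last m) u - F j.castSucc u = 0 := hker
      linarith
  rw [ncard_orders_succ_eq_sum_cuts, Finset.sum_congr rfl hcuts, Finset.sum_add_distrib,
    Finset.sum_card_bipartiteAbove_eq_sum_card_bipartiteBelow, Finset.sum_congr rfl hmeet,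
    Finset.sum_const, smul_eq_mul, mul_one,
    Set.ncard_eq_toFinset_card _ (Set.toFinite (orders G S)), add_comm]

theorem ncard_orders_one (F : Fin 1 → Module.Dual ℝ V) (S : Submodule ℝ V) :
    (orders F S).ncard = 1 := by
  rw [Set.ncard_eq_one]
  refine ⟨∅, Set.eq_singleton_iff_unique_mem.2 ⟨⟨0, S.zero_mem, ?_, ?_⟩, ?_⟩⟩
  · exact fun i j _ => Subsingleton.elim i j
  · ext ⟨i, j⟩
    simp [code]
  · rintro s ⟨u, hu⟩
    ext ⟨i, j⟩
    rw [← lt_iff_of_mem_cell hu, Subsingleton.elim i j]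
    simp

end Recursion

/-! ### The recursion for the Stirling sum -/

theorem c_succ (n : ℕ) (hn : n ≠ 0) (k : ℤ) : c (n + 1) k = c n (k - 1) + n * c n k := by
  unfold c
  rcases lt_trichotomy k 0 with hk | rfl | hk
  · simp [hk, show k - 1 < 0 by omega]
  · obtain ⟨n, rfl⟩ := Nat.exists_eq_succ_of_ne_zero hn
    simp [Nat.stirlingFirst_succ_zero]
  · obtain ⟨j, rfl⟩ : ∃ j : ℕ, k = (j : ℤ) + 1 := ⟨(k - 1).toNat, by omega⟩
    rw [if_neg (by omega), if_neg (by omega), if_neg (by omega), add_sub_cancel_right,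
      show ((j : ℤ) + 1).toNat = j + 1 by omega, Int.toNat_natCast, Nat.stirlingFirst_succ_succ,
      add_comm]

theorem c_eq_zero_of_lt {n : ℕ} {k : ℤ} (h : (n : ℤ) < k) : c n k = 0 := by
  rw [c, if_neg (by omega), Nat.stirlingFirst_eq_zero_of_lt (by omega)]

theorem bound_zero (m : ℕ) : bound 0 m = 0 := by simp [bound]

theorem bound_succ_succ (d m : ℕ) (hm : m ≠ 0) :
    bound (d + 1) (m + 1) = bound (d + 1) m + m * bound d m := by
  have h : ∀ i : ℕ, c (m + 1) (((m + 1 : ℕ) : ℤ) - ((d + 1 : ℕ) : ℤ) + 1 + 2 * (i : ℤ)) =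
      c m ((m : ℤ) - ((d + 1 : ℕ) : ℤ) + 1 + 2 * (i : ℤ)) +
        m * c m ((m : ℤ) - (d : ℤ) + 1 + 2 * (i : ℤ)) := by
    intro i
    rw [c_succ m hm]
    congr 2
    · push_cast; ring_nf
    · push_cast; ring_nf
  simp only [bound]
  rw [Finset.sum_congr rfl (fun i _ => h i), Finset.sum_add_distrib, ← Finset.mul_sum,
    Finset.sum_range_succ (fun i => c m ((m : ℤ) - (d : ℤ) + 1 + 2 * (i : ℤ))),
    c_eq_zero_of_lt (show (m : ℤ) < (m : ℤ) - (d : ℤ) + 1 + 2 * (d : ℤ) by omega)]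
  ring

theorem bound_succ_two (d : ℕ) : bound (d + 1) 2 = 2 := by
  -- `1` and `2` are the only `k` with `c 2 k ≠ 0`, and parity selects one of them
  rw [bound, Finset.sum_eq_single (d / 2)]
  · rcases Nat.even_or_odd' d with ⟨e, rfl | rfl⟩
    · rw [show ((2 : ℕ) : ℤ) - ((2 * e + 1 : ℕ) : ℤ) + 1 + 2 * ((2 * e / 2 : ℕ) : ℤ) = 2 by omega]
      decide
    · rw [show ((2 : ℕ) : ℤ) - ((2 * e + 1 + 1 : ℕ) : ℤ) + 1 + 2 * (((2 * e + 1) / 2 : ℕ) : ℤ) = 1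
        by omega]
      decide
  · intro i _ hi
    rcases lt_or_gt_of_ne hi with h | h
    · rw [c]
      split_ifs with hk
      · rfl
      · rw [show (((2 : ℕ) : ℤ) - ((d + 1 : ℕ) : ℤ) + 1 + 2 * (i : ℤ)).toNat = 0 by omega]
        decide
    · exact c_eq_zero_of_lt (by omega)
  · intro h
    exact absurd (Finset.mem_range.2 (by omega)) h

/-! ### The upper bound -/

section Count

variable {V : Type*} [AddCommGroup V] [Module ℝ V]

theorem finrank_inf_ker_add_one [FiniteDimensional ℝ V] (S : Submodule ℝ V) (φ : Module.Dual ℝ V)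
    (h : ∃ w ∈ S, φ w ≠ 0) :
    Module.finrank ℝ (S ⊓ LinearMap.ker φ : Submodule ℝ V) + 1 = Module.finrank ℝ S := by
  obtain ⟨w, hw, hne⟩ := h
  have hres : φ.domRestrict S ≠ 0 := fun h0 => hne (LinearMap.congr_fun h0 ⟨w, hw⟩)
  rw [← Module.Dual.finrank_ker_add_one_of_ne_zero hres, LinearMap.ker_domRestrict,
    ← Submodule.finrank_map_subtype_eq, Submodule.map_comap_subtype]

theorem orders_eq_empty {m : ℕ} {F : Fin m → Module.Dual ℝ V} {S : Submodule ℝ V} {i j : Fin m}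
    (hij : i ≠ j) (h : ∀ w ∈ S, F i w = F j w) : orders F S = ∅ :=
  Set.eq_empty_of_forall_notMem fun _ ⟨u, hu⟩ => hij (hu.2.1 (h u hu.1))

/-- No condition on the functionals is needed: if two of them agree on `S`, no order is induced. -/
theorem ncard_orders_le [FiniteDimensional ℝ V] {m : ℕ} (hm : 2 ≤ m)
    (F : Fin m → Module.Dual ℝ V) (S : Submodule ℝ V) :
    (orders F S).ncard ≤ bound (Module.finrank ℝ S) m := by
  induction m, hm using Nat.le_induction generalizing S with
  | base =>
    by_cases h : ∀ j : Fin 1, ∃ w ∈ S, F j.castSucc w ≠ F (Fin.last 1) w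
    · have hd := finrank_inf_ker_add_one S (F 0 - F 1)
        (by obtain ⟨w, hw, hne⟩ := h 0; exact ⟨w, hw, sub_ne_zero.2 hne⟩)
      rw [ncard_orders_succ F S h, ← hd, bound_succ_two]
      simp [ncard_orders_one]
    · push Not at h
      obtain ⟨j, hj⟩ := h
      rw [orders_eq_empty (Fin.castSucc_lt_last j).ne hj]
      simp
  | succ m hm ih =>
    by_cases h : ∀ j : Fin m, ∃ w ∈ S, F j.castSucc w ≠ F (Fin.last m) w
    · have hd : ∀ j : Fin m, Module.finrank ℝ
          (S ⊓ LinearMap.ker (F (Fin.last m) - F j.castSucc) : Submodule ℝ V) + 1 =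
            Module.finrank ℝ S := by
        intro j
        obtain ⟨w, hw, hne⟩ := h j
        exact finrank_inf_ker_add_one S _ ⟨w, hw, sub_ne_zero.2 hne.symm⟩
      obtain ⟨d, hd'⟩ : ∃ d, Module.finrank ℝ S = d + 1 := ⟨_, (hd ⟨0, by omega⟩).symm⟩
      rw [ncard_orders_succ F S h, hd', bound_succ_succ d m (by omega), ← hd']
      refine add_le_add (ih _ S) ?_
      calc _ ≤ ∑ _j : Fin m, bound d m := by
            refine Finset.sum_le_sum fun j _ => (ih _ _).trans_eq ?_
            rw [show Module.finrank ℝ (S ⊓ LinearMap.ker (F (Fin.last m) - F j.castSucc) :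
              Submodule ℝ V) = d by have := hd j; omega]
        _ = m * bound d m := by simp
    · push Not at h
      obtain ⟨j, hj⟩ := h
      rw [orders_eq_empty (Fin.castSucc_lt_last j).ne hj]
      simp

end Count

/-! ### Functionals in general position -/

section Generic

variable {V : Type*} [AddCommGroup V] [Module ℝ V]

/-- The subspace on which `f i = f (J i)` for all `i < n`.  A function with `J i ≤ i` encodes a
forest on the indices: `J i` is the parent of `i`, and the roots are the `i` with `J i = i`. -/
def flat (f : ℕ → Module.Dual ℝ V) (J : ℕ → ℕ) (n : ℕ) : Submodule ℝ V :=
  ⨅ i : Fin n, LinearMap.ker (f i - f (J i))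

/-- The number of edges of the forest on the indices below `n` encoded by `J`. -/
def edges (J : ℕ → ℕ) (n : ℕ) : ℕ := ((Finset.range n).filter fun i => J i ≠ i).card

/-- The first `n` functionals are in general position if every forest on their indices imposes
independent conditions, as far as the dimension allows: the truncated subtraction makes the
dimension `0` beyond that. -/
def Generic (f : ℕ → Module.Dual ℝ V) (n : ℕ) : Prop :=
  ∀ J : ℕ → ℕ, (∀ i, J i ≤ i) → Module.finrank ℝ (flat f J n) = Module.finrank ℝ V - edges J n

theorem mem_flat {f : ℕ → Module.Dual ℝ V} {J : ℕ → ℕ} {n : ℕ} {u : V} :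
    u ∈ flat f J n ↔ ∀ i < n, f i u = f (J i) u := by
  simp only [flat, Submodule.mem_iInf, LinearMap.mem_ker, LinearMap.sub_apply, sub_eq_zero]
  exact ⟨fun h i hi => h ⟨i, hi⟩, fun h i => h i i.2⟩

theorem flat_succ (f : ℕ → Module.Dual ℝ V) (J : ℕ → ℕ) (n : ℕ) :
    flat f J (n + 1) = flat f J n ⊓ LinearMap.ker (f n - f (J n)) := by
  ext u
  simp only [Submodule.mem_inf, mem_flat, LinearMap.mem_ker, LinearMap.sub_apply, sub_eq_zero,
    Nat.lt_succ_iff_lt_or_eq, or_imp, forall_and, forall_eq]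

theorem flat_congr {f g : ℕ → Module.Dual ℝ V} {J : ℕ → ℕ} (hJ : ∀ i, J i ≤ i) {n : ℕ}
    (h : ∀ i < n, f i = g i) : flat f J n = flat g J n := by
  refine iInf_congr fun i => ?_
  rw [h i i.2, h (J i) ((hJ i).trans_lt i.2)]

theorem edges_succ (J : ℕ → ℕ) (n : ℕ) :
    edges J (n + 1) = edges J n + if J n = n then 0 else 1 := by
  rw [edges, Finset.range_add_one, Finset.filter_insert]
  by_cases h : J n = n
  · rw [if_neg (not_not.2 h), if_pos h, edges, add_zero]
  · rw [if_pos h, if_neg h, Finset.card_insert_of_notMem (by simp), edges]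

/-- Attaching the root `m` to a vertex `j` cuts the flat by one more hyperplane. -/
theorem flat_update (f : ℕ → Module.Dual ℝ V) {J : ℕ → ℕ} {m n : ℕ} (j : ℕ) (hmn : m < n)
    (hm : J m = m) :
    flat f (Function.update J m j) n = flat f J n ⊓ LinearMap.ker (f m - f j) := by
  ext u
  simp only [Submodule.mem_inf, mem_flat, LinearMap.mem_ker, LinearMap.sub_apply, sub_eq_zero]
  constructor
  · refine fun h => ⟨fun i hi => ?_, by simpa using h m hmn⟩
    by_cases him : i = m
    · rw [him, hm]
    · simpa [him] using h i hi
  · rintro ⟨h, hj⟩ i hi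
    by_cases him : i = m
    · subst him; simpa using hj
    · simpa [him] using h i hi

theorem edges_update {J : ℕ → ℕ} {m n j : ℕ} (hmn : m < n) (hm : J m = m) (hj : j ≠ m) :
    edges (Function.update J m j) n = edges J n + 1 := by
  rw [edges, edges, ← Finset.card_insert_of_notMem (a := m) (by simp [hm])]
  congr 1
  ext i
  by_cases him : i = m
  · subst him; simp [hj, hmn]
  · simp [him]

theorem edges_id (n : ℕ) : edges id n = 0 := by simp [edges]

/-- Functionals can be chosen outside finitely many proper affine subspaces of the dual space. -/
theorem exists_dual_forall_apply_ne {ι κ : Type*} [Finite ι] [Finite κ] (w : ι → V)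
    (hw : ∀ i, w i ≠ 0) (b : κ → Module.Dual ℝ V) :
    ∃ a : Module.Dual ℝ V, ∀ i k, a (w i) ≠ b k (w i) := by
  obtain ⟨a, ha⟩ := Module.exists_dual_forall_apply_ne_zero (K := ℝ) w hw
  obtain ⟨t, ht⟩ := (Set.finite_range fun q : ι × κ => b q.2 (w q.1) / a (w q.1)).exists_notMem
  refine ⟨t • a, fun i k h => ht ⟨(i, k), ?_⟩⟩
  change b k (w i) / a (w i) = t
  rw [← h, LinearMap.smul_apply, smul_eq_mul, mul_div_assoc, div_self (ha i), mul_one]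

/-- A single edge already imposes a condition, so the functionals are distinct. -/
theorem Generic.injOn {f : ℕ → Module.Dual ℝ V} {n : ℕ} (hf : Generic f n)
    (hV : 0 < Module.finrank ℝ V) : Set.InjOn f (Set.Iio n) := by
  have key : ∀ i < n, ∀ j < i, f i ≠ f j := by
    intro i hi j hji heq
    have hJ : ∀ k, Function.update id i j k ≤ k := by
      intro k
      by_cases hk : k = i
      · subst hk; simpa using hji.le
      · simp [hk]
    have h := hf _ hJ
    rw [flat_update f j hi rfl, edges_update hi rfl hji.ne, heq, sub_self, LinearMap.ker_zero,
      inf_top_eq, hf id (fun _ => le_rfl), edges_id] at h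
    omega
  intro i hi j hj hij
  rcases lt_trichotomy i j with h | h | h
  · exact absurd hij.symm (key j hj i h)
  · exact h
  · exact absurd hij (key i hi j h)

variable [FiniteDimensional ℝ V]

/-- Nonvanishing is included because a hyperplane `φ x = 1` needs `φ ≠ 0`. -/
theorem exists_generic (hV : 0 < Module.finrank ℝ V) (n : ℕ) :
    ∃ f : ℕ → Module.Dual ℝ V, Generic f n ∧ ∀ i < n, f i ≠ 0 := by
  classical
  induction n with
  | zero =>
    refine ⟨0, fun J _ => ?_, by simp⟩
    rw [flat, iInf_of_empty, finrank_top]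
    simp [edges]
  | succ n ih =>
    obtain ⟨f, hf, hf0⟩ := ih
    let K : (Fin n → Fin n) → Submodule ℝ V := fun g => ⨅ i : Fin n, LinearMap.ker (f i - f (g i))
    have hK : ∀ g : {g // K g ≠ ⊥}, ∃ w ∈ K g.1, w ≠ 0 := fun g =>
      (Submodule.ne_bot_iff _).1 g.2
    choose w hwK hw0 using hK
    -- the value `0` is avoided as well, to keep the new functional nonzero
    obtain ⟨a, ha⟩ := exists_dual_forall_apply_ne w hw0
      (fun k : Fin (n + 1) => if (k : ℕ) < n then f k else 0)
    have hnew : ∀ J : ℕ → ℕ, (∀ i, J i ≤ i) → flat f J n ≠ ⊥ →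
        ∃ w ∈ flat f J n, (∀ j < n, a w ≠ f j w) ∧ a w ≠ 0 := by
      intro J hJ hne
      let g : Fin n → Fin n := fun i => ⟨J i, (hJ i).trans_lt i.2⟩
      refine ⟨w ⟨g, hne⟩, hwK ⟨g, hne⟩, fun j hj => ?_, ?_⟩
      · simpa [hj] using ha ⟨g, hne⟩ ⟨j, by omega⟩
      · simpa using ha ⟨g, hne⟩ (Fin.last n)
    have hold : ∀ i < n, Function.update f n a i = f i := fun i hi =>
      Function.update_of_ne hi.ne _ _
    refine ⟨Function.update f n a, fun J hJ => ?_, fun i hi => ?_⟩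
    · rw [flat_succ, edges_succ, flat_congr hJ hold]
      by_cases hn : J n = n
      · rw [hn, sub_self, LinearMap.ker_zero, inf_top_eq, hf J hJ]
        simp
      · have hlt : J n < n := lt_of_le_of_ne (hJ n) hn
        rw [if_neg hn, Function.update_self, hold _ hlt]
        by_cases hbot : flat f J n = ⊥
        · have := hf J hJ
          rw [hbot, finrank_bot] at this
          rw [hbot, bot_inf_eq, finrank_bot]
          omega
        · obtain ⟨w, hw, hwj, -⟩ := hnew J hJ hbot
          have := finrank_inf_ker_add_one (flat f J n) (a - f (J n))
            ⟨w, hw, sub_ne_zero.2 (hwj _ hlt)⟩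
          have := hf J hJ
          omega
    · rcases Nat.lt_succ_iff_lt_or_eq.1 hi with h | rfl
      · rw [hold i h]; exact hf0 i h
      · rw [Function.update_self]
        have hid : flat f id i ≠ ⊥ := by
          intro hbot
          have := hf id (fun _ => le_rfl)
          rw [hbot, finrank_bot, edges_id] at this
          omega
        obtain ⟨w, -, -, hw⟩ := hnew id (fun _ => le_rfl) hid
        rintro rfl
        simp at hw

/-- In general position the recursion holds with equality on every flat of a forest in which the
indices below `m` are roots. -/
theorem Generic.ncard_orders {f : ℕ → Module.Dual ℝ V} {n : ℕ} (hf : Generic f n) {m : ℕ}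
    (hm : 2 ≤ m) (hmn : m ≤ n) {J : ℕ → ℕ} (hJ : ∀ i, J i ≤ i) (hroot : ∀ i < m, J i = i) :
    (orders (fun i : Fin m => f i) (flat f J n)).ncard =
      bound (Module.finrank ℝ (flat f J n)) m := by
  have hle : ∀ m, ∀ j < m, ∀ J : ℕ → ℕ, (∀ i, J i ≤ i) →
      ∀ i, Function.update J m j i ≤ i := by
    intro m j hj J hJ i
    by_cases hi : i = m
    · subst hi; simpa using hj.le
    · simpa [hi] using hJ i
  have hcut : ∀ m < n, ∀ j < m, ∀ J : ℕ → ℕ, (∀ i, J i ≤ i) → J m = m →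
      Module.finrank ℝ (flat f J n ⊓ LinearMap.ker (f m - f j) : Submodule ℝ V) =
        Module.finrank ℝ (flat f J n) - 1 := by
    intro m hm j hj J hJ hroot
    rw [← flat_update f j hm hroot, hf _ (hle m j hj J hJ), hf J hJ,
      edges_update hm hroot hj.ne]
    omega
  -- a root that could be attached without effect would make the flat too large
  have hsep : ∀ m < n, ∀ j < m, ∀ J : ℕ → ℕ, (∀ i, J i ≤ i) → J m = m →
      0 < Module.finrank ℝ (flat f J n) → ∃ w ∈ flat f J n, f j w ≠ f m w := by
    intro m hm j hj J hJ hroot hpos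
    by_contra! hcon
    have h := hcut m hm j hj J hJ hroot
    rw [inf_eq_left.2 (fun w hw => by simp [hcon w hw])] at h
    omega
  have hzero : ∀ m, 2 ≤ m → ∀ J : ℕ → ℕ, Module.finrank ℝ (flat f J n) = 0 →
      orders (fun i : Fin m => f i) (flat f J n) = ∅ := by
    intro m hm J h0
    rw [Submodule.finrank_eq_zero.1 h0]
    refine orders_eq_empty (i := ⟨0, by omega⟩) (j := ⟨1, by omega⟩) (by simp) fun w hw => ?_
    rw [(Submodule.mem_bot ℝ).1 hw, map_zero, map_zero]
  induction m, hm using Nat.le_induction generalizing J with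
  | base =>
    rcases Nat.eq_zero_or_pos (Module.finrank ℝ (flat f J n)) with h0 | hpos
    · rw [hzero 2 le_rfl J h0, h0, bound_zero, Set.ncard_empty]
    · obtain ⟨d, hd⟩ := Nat.exists_eq_succ_of_ne_zero hpos.ne'
      rw [ncard_orders_succ (m := 1), hd, bound_succ_two]
      · simp [ncard_orders_one]
      · exact fun j => hsep 1 (by omega) j j.2 J hJ (hroot 1 (by omega)) hpos
  | succ m hm ih =>
    rcases Nat.eq_zero_or_pos (Module.finrank ℝ (flat f J n)) with h0 | hpos
    · rw [hzero (m + 1) (by omega) J h0, h0, bound_zero, Set.ncard_empty]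
    · obtain ⟨d, hd⟩ := Nat.exists_eq_succ_of_ne_zero hpos.ne'
      have hm' : m < n := by omega
      have hJm := hroot m (by omega)
      rw [ncard_orders_succ (m := m), hd, bound_succ_succ d m (by omega)]
      · congr 1
        · exact (ih (by omega) hJ (fun i hi => hroot i (by omega))).trans (by rw [hd])
        · have : ∀ j : Fin m, (orders (fun i : Fin m => f i)
              (flat f J n ⊓ LinearMap.ker (f m - f j))).ncard = bound d m := by
            intro j
            have h := ih (by omega) (hle m j j.2 J hJ) (fun i hi => by
              rw [Function.update_of_ne hi.ne, hroot i (by omega)])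
            rw [flat_update f j hm' hJm, hcut m hm' j j.2 J hJ hJm, hd] at h
            exact h
          exact (Finset.sum_congr rfl fun j _ => this j).trans (by simp)
      · exact fun j => hsep m hm' j j.2 J hJ hJm hpos

theorem Generic.ncard_orders_top {f : ℕ → Module.Dual ℝ V} {m : ℕ} (hf : Generic f m)
    (hm : 2 ≤ m) :
    (orders (fun i : Fin m => f i) ⊤).ncard = bound (Module.finrank ℝ V) m := by
  have h := hf.ncard_orders hm le_rfl (J := id) (fun _ => le_rfl) (fun _ _ => rfl)
  rwa [show flat f id m = ⊤ from eq_top_iff.2 fun u _ => mem_flat.2 fun _ _ => rfl, finrank_top]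
    at h

end Generic

/-! ### From valid orderings to orders of functionals -/

/-- Inverting the parameters turns the order of traversal into the decreasing order of `ℝ`. -/
theorem before_inv_iff {a b : ℝ} (ha : a ≠ 0) (hb : b ≠ 0) : Before a⁻¹ b⁻¹ ↔ b < a := by
  unfold Before
  rcases lt_or_gt_of_ne ha with ha' | ha' <;> rcases lt_or_gt_of_ne hb with hb' | hb'
  · simp [inv_lt_inv_of_neg ha' hb', ha', hb', ha'.not_gt]
  · simp [ha', hb', ha'.not_gt, hb'.not_gt, (ha'.trans hb').not_gt]
  · simp [ha', hb', hb'.trans ha']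
  · simp [inv_lt_inv₀ ha' hb', ha', hb', ha'.not_gt, hb'.not_gt]

theorem IsHyperplane.exists_dual {d : ℕ} {H : AffineSubspace ℝ (Fin d → ℝ)} (hH : IsHyperplane H)
    {p : Fin d → ℝ} (hp : p ∉ H) :
    ∃ φ : Module.Dual ℝ (Fin d → ℝ), ∀ x, x ∈ H ↔ φ (x - p) = 1 := by
  obtain ⟨⟨x₀, hx₀⟩, hfin⟩ := hH
  have hmem : ∀ x, x ∈ H ↔ x - x₀ ∈ H.direction := fun x =>
    (AffineSubspace.vsub_right_mem_direction_iff_mem hx₀ x).symm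
  have hnot : x₀ - p ∉ H.direction := by
    intro h
    exact hp ((hmem p).2 (by simpa using H.direction.neg_mem h))
  obtain ⟨f, hf, hbot⟩ := Submodule.exists_dual_map_eq_bot_of_notMem hnot inferInstance
  have hker : H.direction = LinearMap.ker f := by
    refine Submodule.eq_of_le_of_finrank_eq (LinearMap.le_ker_iff_map.2 hbot) ?_
    have h0 : f ≠ 0 := by rintro rfl; simp at hf
    have := Module.Dual.finrank_ker_add_one_of_ne_zero h0
    rw [Module.finrank_fin_fun] at this
    omega
  refine ⟨(f (x₀ - p))⁻¹ • f, fun x => ?_⟩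
  rw [hmem, hker, LinearMap.mem_ker, LinearMap.smul_apply, smul_eq_mul, inv_mul_eq_one₀ hf,
    show x - x₀ = (x - p) - (x₀ - p) by abel, map_sub, sub_eq_zero, eq_comm]

theorem exists_isHyperplane {d : ℕ} {φ : Module.Dual ℝ (Fin d → ℝ)} (hφ : φ ≠ 0) :
    ∃ H : AffineSubspace ℝ (Fin d → ℝ), IsHyperplane H ∧ ∀ x, x ∈ H ↔ φ x = 1 := by
  obtain ⟨x₀, hx₀⟩ := LinearMap.surjective hφ 1
  refine ⟨AffineSubspace.mk' x₀ (LinearMap.ker φ), ⟨⟨x₀, AffineSubspace.self_mem_mk' _ _⟩, ?_⟩, ?_⟩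
  · rw [AffineSubspace.direction_mk', Module.Dual.finrank_ker_add_one_of_ne_zero hφ,
      Module.finrank_fin_fun]
  · intro x
    rw [AffineSubspace.mem_mk', LinearMap.mem_ker, vsub_eq_sub, map_sub, hx₀, sub_eq_zero]

/-- A hyperplane that avoids the origin determines its equation `φ x = 1`. -/
theorem dual_eq_of_mem_iff {d : ℕ} {H : AffineSubspace ℝ (Fin d → ℝ)}
    (hne : (H : Set (Fin d → ℝ)).Nonempty) {φ ψ : Module.Dual ℝ (Fin d → ℝ)}
    (hφ : ∀ x, x ∈ H ↔ φ x = 1) (hψ : ∀ x, x ∈ H ↔ ψ x = 1) : φ = ψ := by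
  obtain ⟨x₀, hx₀⟩ := hne
  have h1 := (hφ x₀).1 hx₀
  have h2 := (hψ x₀).1 hx₀
  refine LinearMap.ext fun x => ?_
  -- a translate of `x` along `x₀` lies on `H`
  have h := (hψ (x + (1 - φ x) • x₀)).1 ((hφ _).2 (by simp [h1]))
  rw [map_add, map_smul, h2, smul_eq_mul, mul_one] at h
  linarith

/-- Every realised order is realised by a vector at which no functional vanishes. -/
theorem exists_mem_cell_forall_ne_zero {V : Type*} [AddCommGroup V] [Module ℝ V] {m : ℕ}
    {φ : Fin m → Module.Dual ℝ V} (hφ : ∀ i, φ i ≠ 0) {σ : Set (Fin m × Fin m)}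
    (hσ : σ ∈ orders φ ⊤) : ∃ u ∈ cell φ ⊤ σ, ∀ i, φ i u ≠ 0 := by
  obtain ⟨u, hu⟩ := hσ
  obtain ⟨w, hw⟩ := Module.Dual.exists_forall_ne_zero_of_forall_exists φ
    (fun i => by simpa [LinearMap.ext_iff] using hφ i)
  have h : ∀ᶠ ε : ℝ in 𝓝[≠] 0, ∀ i, φ i (u + ε • w) ≠ 0 := by
    rw [eventually_all]
    intro i
    by_cases hi : φ i u = 0
    · filter_upwards [self_mem_nhdsWithin] with ε hε
      simpa [hi, hw i] using hε
    · refine Filter.Eventually.filter_mono nhdsWithin_le_nhds ?_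
      have hc : ContinuousAt (fun ε : ℝ => φ i u + ε * φ i w) 0 := by fun_prop
      have := hc.eventually_ne (y := 0) (by simpa using hi)
      simpa using this
  have hcell := eventually_add_smul_mem_cell hu (Submodule.mem_top (x := w))
  obtain ⟨ε, hε, hε'⟩ := ((hcell.filter_mono nhdsWithin_le_nhds).and h).exists
  exact ⟨_, hε, hε'⟩

section Translation

variable {d m : ℕ} {A : Finset (AffineSubspace ℝ (Fin d → ℝ))} {p : Fin d → ℝ}
  {e : Fin m → AffineSubspace ℝ (Fin d → ℝ)} {φ : Fin m → Module.Dual ℝ (Fin d → ℝ)}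

/-- The crossing parameter is the inverse of the value of the dual functional. -/
theorem Crosses.eq_inv {u : Fin d → ℝ} {t : AffineSubspace ℝ (Fin d → ℝ) → ℝ}
    (h : Crosses A p u t) (heA : ∀ i, e i ∈ A) (hφ : ∀ i x, x ∈ e i ↔ φ i (x - p) = 1)
    (i : Fin m) : φ i u ≠ 0 ∧ t (e i) = (φ i u)⁻¹ := by
  have h1 := (hφ i _).1 (h.2.1 _ (heA i)).2
  rw [add_sub_cancel_left, map_smul, smul_eq_mul] at h1
  exact ⟨right_ne_zero_of_mul_eq_one h1, eq_inv_of_mul_eq_one_left h1⟩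

/-- The crossing parameters are prescribed on the hyperplanes `e i` and zero elsewhere, where they
play no role. -/
theorem crosses_of_forall_ne_zero (hm : 0 < m) (hinj : Function.Injective e)
    (heA : ∀ H, H ∈ A ↔ ∃ i, e i = H) (hne : ∀ i, (e i : Set (Fin d → ℝ)).Nonempty)
    (hφ : ∀ i x, x ∈ e i ↔ φ i (x - p) = 1) {u : Fin d → ℝ}
    (hu : Function.Injective fun i => φ i u) (hu0 : ∀ i, φ i u ≠ 0) :
    Crosses A p u (Function.extend e (fun i => (φ i u)⁻¹) 0) := by
  refine ⟨?_, ?_, ?_⟩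
  · rintro rfl
    exact hu0 ⟨0, hm⟩ (map_zero _)
  · intro H hH
    obtain ⟨i, rfl⟩ := (heA H).1 hH
    constructor
    · intro hdir
      obtain ⟨x, hx⟩ := hne i
      have h1 := (hφ i _).1 hx
      have h2 := (hφ i _).1 ((AffineSubspace.vadd_mem_iff_mem_direction u hx).2 hdir)
      rw [vadd_eq_add, add_sub_assoc, map_add, h1] at h2
      exact hu0 i (by linarith)
    · rw [hinj.extend_apply, hφ, add_sub_cancel_left, map_smul, smul_eq_mul,
        inv_mul_cancel₀ (hu0 i)]
  · intro H hH H' hH' heq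
    obtain ⟨i, rfl⟩ := (heA H).1 hH
    obtain ⟨j, rfl⟩ := (heA H').1 hH'
    rw [hinj.extend_apply, hinj.extend_apply, inv_inj] at heq
    rw [hu heq]

/-- The order of the indices in which earlier entries of `l` are larger: `(i, j)` belongs to it when
`e j` is listed before `e i`.  The reversal matches `before_inv_iff`. -/
def listCode (e : Fin m → AffineSubspace ℝ (Fin d → ℝ)) (l : List (AffineSubspace ℝ (Fin d → ℝ))) :
    Set (Fin m × Fin m) :=
  {q | [e q.2, e q.1].Sublist l}

theorem listCode_eq (hinj : Function.Injective e)
    {l : List (AffineSubspace ℝ (Fin d → ℝ))} (hl : ∀ i, e i ∈ l) {u : Fin d → ℝ}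
    (hp : ∀ i j, [e i, e j].Sublist l → φ j u < φ i u) :
    listCode e l = code φ u := by
  ext ⟨i, j⟩
  refine ⟨hp j i, fun hlt : φ i u < φ j u => ?_⟩
  obtain ⟨s, t, rfl⟩ := List.append_of_mem (hl j)
  rcases List.mem_append.1 (hl i) with h | h
  · have : [e i, e j].Sublist (s ++ e j :: t) :=
      (List.singleton_sublist.2 h).append (List.singleton_sublist.2 List.mem_cons_self)
    exact absurd (hp i j this) hlt.not_gt
  · rcases List.mem_cons.1 h with h | h
    · exact absurd hlt (hinj h ▸ lt_irrefl _)
    · exact ((List.singleton_sublist.2 h).cons_cons (e j)).trans (List.sublist_append_right _ _)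

theorem IsValidOrdering.exists_pairwise {l : List (AffineSubspace ℝ (Fin d → ℝ))}
    (hl : IsValidOrdering A p l) (heA : ∀ H, H ∈ A ↔ ∃ i, e i = H)
    (hinj : Function.Injective e) (hφ : ∀ i x, x ∈ e i ↔ φ i (x - p) = 1) :
    ∃ u, (Function.Injective fun i => φ i u) ∧
      ∀ i j, [e i, e j].Sublist l → φ j u < φ i u := by
  obtain ⟨-, -, u, t, hc, hpw⟩ := hl
  have ht := hc.eq_inv (fun i => (heA _).2 ⟨i, rfl⟩) hφ
  refine ⟨u, fun i j hij => ?_, fun i j hij => ?_⟩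
  · refine hinj (hc.2.2 ((heA _).2 ⟨i, rfl⟩) ((heA _).2 ⟨j, rfl⟩) ?_)
    rw [(ht i).2, (ht j).2]
    exact congrArg _ hij
  · have := List.pairwise_iff_forall_sublist.1 hpw hij
    rwa [(ht i).2, (ht j).2, before_inv_iff (ht i).1 (ht j).1] at this

/-- Valid orderings correspond to the orders that vectors induce on the dual functionals. -/
theorem v_eq_ncard_orders (hm : 0 < m) (hinj : Function.Injective e)
    (heA : ∀ H, H ∈ A ↔ ∃ i, e i = H) (hne : ∀ i, (e i : Set (Fin d → ℝ)).Nonempty)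
    (hφ : ∀ i x, x ∈ e i ↔ φ i (x - p) = 1) : v A p = (orders φ ⊤).ncard := by
  classical
  refine Set.ncard_congr (fun l _ => listCode e l) ?_ ?_ ?_
  · intro l hl
    obtain ⟨u, hu, hp⟩ := hl.exists_pairwise heA hinj hφ
    exact ⟨u, Submodule.mem_top, hu,
      (listCode_eq hinj (fun i => (hl.2.1 _).2 ((heA _).2 ⟨i, rfl⟩)) hp).symm⟩
  · intro l l' hl hl' heq
    obtain ⟨u, hu, hp⟩ := hl.exists_pairwise heA hinj hφ
    have hp' : ∀ i j, [e i, e j].Sublist l' → φ j u < φ i u := fun i j h =>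
      hp i j ((Set.ext_iff.1 heq (j, i)).2 h)
    have hpw : ∀ l : List (AffineSubspace ℝ (Fin d → ℝ)), IsValidOrdering A p l →
        (∀ i j, [e i, e j].Sublist l → φ j u < φ i u) →
        l.Pairwise fun H H' => ∃ i j, e i = H ∧ e j = H' ∧ φ j u < φ i u := by
      intro l hl hp
      refine List.pairwise_iff_forall_sublist.2 fun {H H'} h => ?_
      obtain ⟨i, rfl⟩ := (heA H).1 ((hl.2.1 H).1 (h.subset (by simp)))
      obtain ⟨j, rfl⟩ := (heA H').1 ((hl.2.1 H').1 (h.subset (by simp)))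
      exact ⟨i, j, rfl, rfl, hp i j h⟩
    refine List.Perm.eq_of_pairwise ?_ (hpw l hl hp) (hpw l' hl' hp')
      ((List.perm_ext_iff_of_nodup hl.1 hl'.1).2 fun H => (hl.2.1 H).trans (hl'.2.1 H).symm)
    rintro H H' - - ⟨i, j, rfl, rfl, hlt⟩ ⟨i', j', hi, hj, hlt'⟩
    rw [hinj hi, hinj hj] at hlt'
    exact absurd hlt' hlt.not_gt
  · intro σ hσ
    have hφ0 : ∀ i, φ i ≠ 0 := by
      rintro i h0
      obtain ⟨x, hx⟩ := hne i
      have := (hφ i x).1 hx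
      simp [h0] at this
    obtain ⟨u, hu, hu0⟩ := exists_mem_cell_forall_ne_zero hφ0 hσ
    let L := (Finset.univ : Finset (Fin m)).toList.insertionSort fun i j => φ j u ≤ φ i u
    have : Std.Total fun i j : Fin m => φ j u ≤ φ i u := ⟨fun i j => le_total _ _⟩
    have : IsTrans (Fin m) fun i j => φ j u ≤ φ i u := ⟨fun i j k h1 h2 => h2.trans h1⟩
    have hperm : L.Perm (Finset.univ : Finset (Fin m)).toList := List.perm_insertionSort _ _
    have hnd : L.Nodup := hperm.nodup_iff.2 (Finset.nodup_toList _)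
    have hsorted : L.Pairwise fun i j => φ j u < φ i u := by
      refine List.Pairwise.imp₂ (fun i j h1 h2 => ?_)
        (List.pairwise_insertionSort (fun i j => φ j u ≤ φ i u) _) hnd
      exact lt_of_le_of_ne h1 fun h => h2 (hu.2.1 h).symm
    have hLmem : ∀ i, e i ∈ L.map e := fun i =>
      List.mem_map_of_mem (hperm.mem_iff.2 (Finset.mem_toList.2 (Finset.mem_univ i)))
    have hp : ∀ i j, [e i, e j].Sublist (L.map e) → φ j u < φ i u := by
      intro i j h
      obtain ⟨i', j', hi, hj, hlt⟩ := List.pairwise_iff_forall_sublist.1 (List.Pairwise.map e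
        (S := fun H H' => ∃ i j, e i = H ∧ e j = H' ∧ φ j u < φ i u)
        (fun i j h => ⟨i, j, rfl, rfl, h⟩) hsorted) h
      rwa [hinj hi, hinj hj] at hlt
    refine ⟨L.map e, ⟨hnd.map hinj, fun H => ?_, u, _,
      crosses_of_forall_ne_zero hm hinj heA hne hφ hu.2.1 hu0, ?_⟩,
      (listCode_eq hinj hLmem hp).trans hu.2.2⟩
    · rw [heA, List.mem_map]
      exact ⟨fun ⟨i, _, h⟩ => ⟨i, h⟩, fun ⟨i, h⟩ => h ▸ List.mem_map.1 (hLmem i)⟩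
    · refine List.Pairwise.map e (fun i j hlt => ?_) hsorted
      rw [hinj.extend_apply, hinj.extend_apply]
      exact (before_inv_iff (hu0 i) (hu0 j)).2 hlt

end Translation

end ValidOrder

theorem mainTheorem2 (d m : ℕ) (hd : 1 ≤ d) (hm : 2 ≤ m) :
    (∀ A : Finset (AffineSubspace ℝ (Fin d → ℝ)), ValidOrder.IsArrangement A → A.card = m →
      ∀ p : Fin d → ℝ, (∀ H ∈ A, p ∉ H) → ValidOrder.v A p ≤ ValidOrder.bound d m) ∧
    (∃ A : Finset (AffineSubspace ℝ (Fin d → ℝ)), ValidOrder.IsArrangement A ∧ A.card = m ∧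
      ∃ p : Fin d → ℝ, (∀ H ∈ A, p ∉ H) ∧ ValidOrder.v A p = ValidOrder.bound d m) := by
  classical
  constructor
  · intro A hA hcard p hp
    let e : Fin m → AffineSubspace ℝ (Fin d → ℝ) := fun i => (A.equivFinOfCardEq hcard).symm i
    have he : ∀ i, e i ∈ A := fun i => ((A.equivFinOfCardEq hcard).symm i).2
    choose φ hφ using fun i => (hA (e i) (he i)).exists_dual (hp _ (he i))
    rw [ValidOrder.v_eq_ncard_orders (e := e) (φ := φ) (by omega)
      (Subtype.val_injective.comp (Equiv.injective _)) ?_ (fun i => (hA (e i) (he i)).1) hφ]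
    · exact (ValidOrder.ncard_orders_le hm φ ⊤).trans_eq
        (by rw [finrank_top, Module.finrank_fin_fun])
    · refine fun H => ⟨fun hH => ⟨A.equivFinOfCardEq hcard ⟨H, hH⟩, by simp [e]⟩, ?_⟩
      rintro ⟨i, rfl⟩
      exact he i
  · have hpos : 0 < Module.finrank ℝ (Fin d → ℝ) := by rw [Module.finrank_fin_fun]; omega
    obtain ⟨f, hf, hf0⟩ := ValidOrder.exists_generic hpos m
    choose e he hmem using fun i : Fin m => ValidOrder.exists_isHyperplane (hf0 i i.2)
    have hinj : Function.Injective e := by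
      intro i j hij
      exact Fin.ext (hf.injOn hpos i.2 j.2
        (ValidOrder.dual_eq_of_mem_iff (he i).1 (hmem i) (hij ▸ hmem j)))
    refine ⟨Finset.univ.image e, ?_, ?_, 0, ?_, ?_⟩
    · intro H hH
      obtain ⟨i, -, rfl⟩ := Finset.mem_image.1 hH
      exact he i
    · rw [Finset.card_image_of_injective _ hinj, Finset.card_univ, Fintype.card_fin]
    · intro H hH
      obtain ⟨i, -, rfl⟩ := Finset.mem_image.1 hH
      simp [hmem]
    · rw [ValidOrder.v_eq_ncard_orders (e := e) (φ := fun i => f i) (by omega) hinj (by simp)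
        (fun i => (he i).1) (by simpa using hmem), hf.ncard_orders_top hm, Module.finrank_fin_fun]
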